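/- Let $\mu_1,\mu_2$ be Borel probability measures on the unit sphere $\mathbb S^2\subset\mathbb R^3$ that are nondegenerate (every great circle has measure $0$) and antipodally symmetric ($\mu_i(-A)=\mu_i(A)$ for every measurable $A\subseteq\mathbb S^2$). For each $n$ choose $2n$ independent points $a_1,\dots,a_n$ with law $\mu_1$ and $b_1,\dots,b_n$ with law $\mu_2$, let $D_n$ be the drawing of $K_{n,n}$ in which the edge $a_ib_j$ is the geodesic segment from $a_i$ to $b_j$, and let $X_n$ be its crossing graph: its vertices are the $n^2$ edges of $D_n$, and two of them are adjacent if they cross. Write $t(H,X_n)=\hom(H,X_n)/|V(X_n)|^{|V(H)|}$, and for a graphon $W$ (a symmetric measurable function $[0,1]^2\to[0,1]$) write $t(H,W)=\int_{[0,1]^{V(H)}}\prod_{vw\in E(H)}W(x_v,x_w)\,dx$. Let $W=W(\mu_1,\mu_2)$ be the limit graphon of $(X_n)$, that is, a graphon such that with probability $1$, $t(H,X_n)\to t(H,W)$ for every finite graph $H$. Then $W$ exists, and every such $W$ satisfies $$t(K_2,W(\mu_1,\mu_2))=\tfrac18 .$$ -/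

import Mathlib

open MeasureTheory ProbabilityTheory Filter Topology
open scoped unitInterval

universe u

noncomputable section

/-! ### Graph homomorphism densities, graphons and graph limits -/

/-- A graphon: a symmetric measurable function `[0,1]² → [0,1]`. -/
structure Graphon where
  toFun : I → I → ℝ
  measurable_toFun : Measurable (Function.uncurry toFun)
  symm : ∀ x y, toFun x y = toFun y x
  mem_Icc : ∀ x y, toFun x y ∈ Set.Icc (0 : ℝ) 1

/-- The value of a graphon on the unordered pair of labels carried by the ends of an edge. -/
def Graphon.edgeValue (W : Graphon) {V : Type*} (x : V → I) : Sym2 V → ℝ :=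
  Sym2.lift ⟨fun v w => W.toFun (x v) (x w), fun v w => W.symm (x v) (x w)⟩

open Classical in
/-- `t(H, W) = ∫_{[0,1]^{V(H)}} ∏_{vw ∈ E(H)} W(x_v, x_w) dx`. -/
def Graphon.homDensity {V : Type*} [Fintype V] (H : SimpleGraph V) (W : Graphon) : ℝ :=
  ∫ x : V → I, ∏ e ∈ H.edgeFinset, W.edgeValue x e

/-- `t(H, G) = hom(H, G) / |V(G)| ^ |V(H)|` for finite graphs `H` and `G`. -/
def graphHomDensity {V V' : Type*} (H : SimpleGraph V) (G : SimpleGraph V') : ℝ :=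
  (Nat.card (H →g G) : ℝ) / (Nat.card V' : ℝ) ^ Nat.card V

/-- The graphon `W` is the limit of the sequence of graphs `X n`:
`t(H, X n) → t(H, W)` for every finite graph `H`. -/
def IsGraphLimit {V : ℕ → Type*} (X : ∀ n, SimpleGraph (V n)) (W : Graphon) : Prop :=
  ∀ (k : ℕ) (H : SimpleGraph (Fin k)),
    Tendsto (fun n => graphHomDensity H (X n)) atTop (𝓝 (W.homDensity H))

/-! ### Probability measures on the unit sphere -/

/-- The unit sphere in `ℝ³`. -/
abbrev S2 : Type := Metric.sphere (0 : EuclideanSpace ℝ (Fin 3)) 1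

/-- The great circle orthogonal to `u`. -/
def greatCircle (u : S2) : Set S2 :=
  {x | inner ℝ (u : EuclideanSpace ℝ (Fin 3)) (x : EuclideanSpace ℝ (Fin 3)) = 0}

/-- Every great circle has measure zero. -/
def Nondegenerate (μ : Measure S2) : Prop :=
  ∀ u : S2, μ (greatCircle u) = 0

/-- Every measurable set has the same measure as its antipodal set. -/
def AntipodallySymmetric (μ : Measure S2) : Prop :=
  ∀ A : Set S2, MeasurableSet A → μ ((fun x => -x) '' A) = μ A

/-! ### Random geodesic drawings of `K_{n,n}` and their crossing graphs -/

/-- The relative interior of the geodesic segment (shorter great circle arc) joining two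
points `a`, `b` of the sphere that are neither equal nor antipodal. -/
def openArc (a b : S2) : Set S2 :=
  {x | ∃ s t : ℝ, 0 < s ∧ 0 < t ∧
    (x : EuclideanSpace ℝ (Fin 3)) = s • (a : EuclideanSpace ℝ (Fin 3)) + t • (b : EuclideanSpace ℝ (Fin 3))}

/-- The crossing graph of the geodesic drawing of `K_{n,n}` with parts `a` and `b`: its vertices
are the edges `(i, j)`, drawn as the geodesic segments from `a i` to `b j`, and two distinct edges
are adjacent when they cross, i.e. share a point interior to both. -/
def crossingGraph {n : ℕ} (a b : Fin n → S2) : SimpleGraph (Fin n × Fin n) where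
  Adj e f := e ≠ f ∧ (openArc (a e.1) (b e.2) ∩ openArc (a f.1) (b f.2)).Nonempty
  symm := ⟨fun _ _ h => ⟨h.1.symm, by rw [Set.inter_comm]; exact h.2⟩⟩
  loopless := ⟨fun _ h => h.1 rfl⟩

/-- For every `n`, the points `A n 0, …, A n (n-1), B n 0, …, B n (n-1)` are independent, the
first `n` with law `μ₁` and the last `n` with law `μ₂`. Nothing is assumed on the joint law for
different values of `n`. -/
def IsRandomDrawingSequence {Ω : Type u} [MeasurableSpace Ω] (μ₁ μ₂ : Measure S2) (P : Measure Ω)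
    (A B : ∀ n : ℕ, Ω → Fin n → S2) : Prop :=
  ∀ n : ℕ, HasLaw (fun ω => (A n ω, B n ω))
    ((Measure.pi fun _ : Fin n => μ₁).prod (Measure.pi fun _ : Fin n => μ₂)) P

/-- `W` is a crossing graphon `W(μ₁, μ₂)`: for every `(μ₁, μ₂)`-random sequence of drawings of
`K_{n,n}`, the crossing graphs converge to `W` with probability one. -/
def IsCrossingGraphon (μ₁ μ₂ : Measure S2) (W : Graphon) : Prop :=
  ∀ (Ω : Type u) [MeasurableSpace Ω] (P : Measure Ω) [IsProbabilityMeasure P]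
    (A B : ∀ n : ℕ, Ω → Fin n → S2), IsRandomDrawingSequence μ₁ μ₂ P A B →
      ∀ᵐ ω ∂P, IsGraphLimit (fun n => crossingGraph (A n ω) (B n ω)) W

end

/-! The graphon is the crossing relation itself. An edge of the random drawing is a pair `(a, b)` of
law `μ₁ × μ₂`; transporting this law to `[0, 1]` along a measurable map `f` turns the indicator of
"the edges cross" into a graphon (`crossingGraphon`), whose `H`-density is the probability
`crossingDensity` that independent edges indexed by the vertices of `H` cross along the edges
of `H`.

The density of `H` in the crossing graph of a drawing is an average, over maps `φ` from the vertices
of `H` to pairs of indices, of the indicators that `φ` is a homomorphism. All but `O(1 / n)` of the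
maps use no point twice, and for these the indicator has expectation `crossingDensity`; hence the
expectations converge (`tendsto_integral_drawingDensity`). Moving the two points `a i`, `b i` changes
the density by `O(1 / n)`, so McDiarmid's inequality
(`hasSubgaussianMGF_pi_of_bounded_differences`) bounds the deviations by `2 exp (-const * n)`.
These bounds are summable, and Borel–Cantelli gives almost sure convergence for every coupling of
the drawings for different `n` (`ae_tendsto_graphHomDensity`). Since some random sequence of
drawings exists, the densities of every crossing graphon are the numbers `crossingDensity`.

It remains to see that two independent edges `ab`, `a'b'` cross with probability `1/8`
(`measureReal_crosses`). Almost surely any three of the four points are linearly independent, so up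
to scaling there is a unique relation `c₀ a + c₁ b = c₂ a' + c₃ b'`, and all `cᵢ` are nonzero. The
edges cross exactly when the `cᵢ` have the same sign. By antipodal symmetry the law is invariant
under replacing each of the points by its antipode, independently, and of the resulting `16` sign
patterns exactly two make the edges cross. -/

/-! ### The bounded differences inequality -/

theorem integral_pi_fin_succ {X : Type*} [MeasurableSpace X] (μ : Measure X)
    [IsProbabilityMeasure μ] {n : ℕ} (F : (Fin (n + 1) → X) → ℝ)
    (hF : Integrable F (Measure.pi fun _ => μ)) :
    ∫ x, F x ∂(Measure.pi fun _ => μ) =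
      ∫ y, ∫ x, F (Fin.cons x y) ∂μ ∂(Measure.pi fun _ : Fin n => μ) := by
  have h := (measurePreserving_piFinSuccAbove (fun _ : Fin (n + 1) => μ) 0).symm
  have h' := h.integrable_comp_emb (MeasurableEquiv.measurableEmbedding _) (g := F)
  rw [← h.integral_comp' F]
  refine (integral_prod_symm _ (h'.2 hF)).trans ?_
  simp [Fin.insertNthEquiv]

/-- **McDiarmid's bounded differences inequality**, in subgaussian form. The fresh coordinate is
integrated out by Hoeffding's lemma, conditionally on the others. -/
theorem hasSubgaussianMGF_pi_of_bounded_differences {X : Type*} [MeasurableSpace X]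
    (μ : Measure X) [IsProbabilityMeasure μ] {n : ℕ} {F : (Fin n → X) → ℝ} (hF : Measurable F)
    {a b : ℝ} (hab : ∀ x, F x ∈ Set.Icc a b) {c : NNReal}
    (hc : ∀ x i y, |F (Function.update x i y) - F x| ≤ c) :
    HasSubgaussianMGF (fun x => F x - ∫ x', F x' ∂(Measure.pi fun _ => μ)) (n * c ^ 2)
      (Measure.pi fun _ => μ) := by
  induction n with
  | zero =>
    have : (fun x => F x - ∫ x', F x' ∂(Measure.pi fun _ : Fin 0 => μ)) = fun _ => 0 := by
      funext x
      have : F = fun _ => F x := by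
        funext y
        rw [Subsingleton.elim y x]
      rw [this]
      simp
    rw [this]
    simp
  | succ n ih =>
    let π := Measure.pi fun _ : Fin n => μ
    have hcons : Measurable fun p : X × (Fin n → X) => (Fin.cons p.1 p.2 : Fin (n + 1) → X) := by
      refine measurable_pi_iff.2 fun i => ?_
      refine Fin.cases ?_ (fun j => ?_) i
      · simpa using measurable_fst
      · simpa using (by fun_prop : Measurable fun p : X × (Fin n → X) => p.2 j)
    have hFc : Measurable fun p : X × (Fin n → X) => F (Fin.cons p.1 p.2) := hF.comp hcons
    have hFy (y : Fin n → X) : Measurable fun x : X => F (Fin.cons x y) :=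
      hFc.comp (by fun_prop : Measurable fun x : X => (x, y))
    have hFi (y : Fin n → X) : Integrable (fun x : X => F (Fin.cons x y)) μ :=
      Integrable.of_mem_Icc a b (hFy y).aemeasurable (ae_of_all _ fun _ => hab _)
    let G : (Fin n → X) → ℝ := fun y => ∫ x, F (Fin.cons x y) ∂μ
    have hG : Measurable G :=
      (hFc.stronglyMeasurable.integral_prod_left' (μ := μ)).measurable
    have hGab : ∀ y, G y ∈ Set.Icc a b := fun y => by
      have h1 := integral_mono (integrable_const a) (hFi y) fun x => (hab _).1
      have h2 := integral_mono (hFi y) (integrable_const b) fun x => (hab _).2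
      simp only [integral_const, probReal_univ, smul_eq_mul, one_mul] at h1 h2
      exact ⟨h1, h2⟩
    have hGc : ∀ x i y, |G (Function.update x i y) - G x| ≤ c := fun y i z => by
      simp only [G]
      rw [← integral_sub (hFi _) (hFi _)]
      have h (x : X) :
          ‖F (Fin.cons x (Function.update y i z)) - F (Fin.cons x y)‖ ≤ c := by
        rw [Fin.cons_update]
        exact hc _ _ _
      simpa using norm_integral_le_of_norm_le_const (μ := μ) (ae_of_all _ h)
    have ihG := ih hG hGab hGc
    have hEF : ∫ x', F x' ∂(Measure.pi fun _ : Fin (n + 1) => μ) = ∫ y, G y ∂π :=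
      integral_pi_fin_succ μ F
        (Integrable.of_mem_Icc a b hF.aemeasurable (ae_of_all _ fun _ => hab _))
    set m := ∫ y, G y ∂π with hm
    have hint (t : ℝ) : Integrable (fun x => Real.exp (t * (F x - m)))
        (Measure.pi fun _ : Fin (n + 1) => μ) :=
      integrable_exp_mul_of_mem_Icc (a := a - m) (b := b - m) (hF.sub_const m).aemeasurable
        (ae_of_all _ fun x => ⟨by linarith [(hab x).1], by linarith [(hab x).2]⟩)
    rw [hEF]
    refine ⟨hint, fun t => ?_⟩
    have hfresh (y : Fin n → X) :
        ∫ x, Real.exp (t * (F (Fin.cons x y) - G y)) ∂μ ≤ Real.exp (c ^ 2 * t ^ 2 / 2) := by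
      have hdiff (x x' : X) : |F (Fin.cons x y) - F (Fin.cons x' y)| ≤ c := by
        have := hc (Fin.cons x' y) 0 x
        rwa [Fin.update_cons_zero] at this
      have hmem (x : X) : F (Fin.cons x y) - G y ∈ Set.Icc (-(c : ℝ)) c := by
        refine abs_le.1 ?_
        have : F (Fin.cons x y) - G y = ∫ x', (F (Fin.cons x y) - F (Fin.cons x' y)) ∂μ := by
          rw [integral_sub (integrable_const _) (hFi y)]
          simp [G]
        rw [this]
        have h (x' : X) : ‖F (Fin.cons x y) - F (Fin.cons x' y)‖ ≤ c := hdiff x x'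
        simpa using norm_integral_le_of_norm_le_const (μ := μ) (ae_of_all _ h)
      have h := (hasSubgaussianMGF_of_mem_Icc_of_integral_eq_zero (μ := μ)
        ((hFy y).sub_const (G y)).aemeasurable (ae_of_all _ hmem)
        (by rw [integral_sub (hFi y) (integrable_const _)]; simp [G])).mgf_le t
      refine h.trans (le_of_eq ?_)
      congr 3
      have : ‖(c : ℝ) - -c‖ = 2 * c := by
        rw [Real.norm_of_nonneg (by linarith [c.2] : (0 : ℝ) ≤ c - -c)]
        ring
      push_cast
      rw [this]
      ring
    calc mgf (fun x => F x - m) (Measure.pi fun _ : Fin (n + 1) => μ) t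
        = ∫ y, ∫ x, Real.exp (t * (F (Fin.cons x y) - m)) ∂μ ∂π :=
          integral_pi_fin_succ μ _ (hint t)
      _ = ∫ y, Real.exp (t * (G y - m)) *
            ∫ x, Real.exp (t * (F (Fin.cons x y) - G y)) ∂μ ∂π := by
          congr 1 with y
          rw [← integral_const_mul]
          congr 1 with x
          rw [← Real.exp_add]
          ring_nf
      _ ≤ ∫ y, Real.exp (t * (G y - m)) * Real.exp (c ^ 2 * t ^ 2 / 2) ∂π := by
          refine integral_mono_of_nonneg (ae_of_all _ fun y => ?_)
            ((ihG.integrable_exp_mul t).mul_const _) (ae_of_all _ fun y => ?_)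
          · exact mul_nonneg (Real.exp_pos _).le (integral_nonneg fun _ => (Real.exp_pos _).le)
          · exact mul_le_mul_of_nonneg_left (hfresh y) (Real.exp_pos _).le
      _ ≤ Real.exp ((n * c ^ 2 : NNReal) * t ^ 2 / 2) * Real.exp (c ^ 2 * t ^ 2 / 2) := by
          rw [integral_mul_const]
          exact mul_le_mul_of_nonneg_right (ihG.mgf_le t) (Real.exp_pos _).le
      _ = Real.exp (((n + 1 : ℕ) * c ^ 2 : NNReal) * t ^ 2 / 2) := by
          rw [← Real.exp_add]
          push_cast
          ring_nf

/-- Selecting distinct coordinates of an i.i.d. family yields an i.i.d. family. -/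
theorem measurePreserving_pi_precomp {X ι κ : Type*} [MeasurableSpace X] [Fintype ι] [Fintype κ]
    (μ : Measure X) [IsProbabilityMeasure μ] {g : κ → ι} (hg : g.Injective) :
    MeasurePreserving (fun (x : ι → X) (j : κ) => x (g j)) (Measure.pi fun _ => μ)
      (Measure.pi fun _ => μ) where
  measurable := by fun_prop
  map_eq := by
    have h := (iIndepFun_pi (μ := fun _ : ι => μ) (X := fun _ x => x)
      fun _ => aemeasurable_id).precomp hg
    rw [iIndepFun_iff_map_fun_eq_pi_map fun j => (measurable_pi_apply (g j)).aemeasurable] at h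
    rw [h]
    congr 1 with i : 1
    exact (measurePreserving_eval (fun _ : ι => μ) (g i)).map_eq

/-! ### The crossing relation -/

/-- Two edges of a geodesic drawing, each given by its pair of ends, cross. -/
def Crosses (p q : S2 × S2) : Prop :=
  (openArc p.1 p.2 ∩ openArc q.1 q.2).Nonempty

theorem Crosses.symm {p q : S2 × S2} (h : Crosses p q) : Crosses q p := by
  rwa [Crosses, Set.inter_comm]

/-- The crossing relation is σ-compact: it is the projection of the relation that also records the
crossing point and the four coefficients, which is a countable union of compact sets. -/
theorem measurableSet_crosses :
    MeasurableSet {z : (S2 × S2) × (S2 × S2) | Crosses z.1 z.2} := by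
  let J : ℕ → Set ℝ := fun k => Set.Icc ((k + 1 : ℝ)⁻¹) (k + 1)
  let C : ℕ → Set (((S2 × S2) × (S2 × S2)) × S2 × (ℝ × ℝ) × (ℝ × ℝ)) := fun k =>
    (Set.univ ×ˢ Set.univ ×ˢ (J k ×ˢ J k) ×ˢ (J k ×ˢ J k)) ∩
      {y | (y.2.1 : EuclideanSpace ℝ (Fin 3)) =
          y.2.2.1.1 • (y.1.1.1 : EuclideanSpace ℝ (Fin 3)) +
          y.2.2.1.2 • (y.1.1.2 : EuclideanSpace ℝ (Fin 3)) ∧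
        (y.2.1 : EuclideanSpace ℝ (Fin 3)) =
          y.2.2.2.1 • (y.1.2.1 : EuclideanSpace ℝ (Fin 3)) +
          y.2.2.2.2 • (y.1.2.2 : EuclideanSpace ℝ (Fin 3))}
  have hC (k : ℕ) : IsCompact (C k) := by
    refine IsCompact.inter_right ?_ ?_
    · exact isCompact_univ.prod (isCompact_univ.prod
        ((isCompact_Icc.prod isCompact_Icc).prod (isCompact_Icc.prod isCompact_Icc)))
    · exact (isClosed_eq (by fun_prop) (by fun_prop)).inter
        (isClosed_eq (by fun_prop) (by fun_prop))
  have hJ {s : ℝ} (hs : 0 < s) : ∀ᶠ k : ℕ in atTop, s ∈ J k := by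
    filter_upwards [eventually_ge_atTop ⌈s⌉₊, eventually_ge_atTop ⌈s⁻¹⌉₊] with k h1 h2
    have h1' : s ≤ k := (Nat.le_ceil s).trans (by exact_mod_cast h1)
    have h2' : s⁻¹ ≤ k := (Nat.le_ceil _).trans (by exact_mod_cast h2)
    exact ⟨inv_le_of_inv_le₀ hs (by linarith), by linarith⟩
  have hJpos {s : ℝ} {k : ℕ} (hs : s ∈ J k) : 0 < s :=
    lt_of_lt_of_le (by positivity) hs.1
  have : {z : (S2 × S2) × (S2 × S2) | Crosses z.1 z.2} = ⋃ k, Prod.fst '' C k := by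
    ext z
    simp only [Set.mem_ofPred_eq, Set.mem_iUnion, Set.mem_image]
    constructor
    · rintro ⟨x, ⟨s, t, hs, ht, h⟩, s', t', hs', ht', h'⟩
      obtain ⟨k, h1, h2, h3, h4⟩ :=
        ((hJ hs).and ((hJ ht).and ((hJ hs').and (hJ ht')))).exists
      exact ⟨k, (z, x, (s, t), (s', t')), ⟨by simp [h1, h2, h3, h4], h, h'⟩, rfl⟩
    · rintro ⟨k, ⟨_, x, ⟨s, t⟩, ⟨s', t'⟩⟩, ⟨⟨-, -, ⟨hs, ht⟩, hs', ht'⟩, h, h'⟩, rfl⟩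
      exact ⟨x, ⟨s, t, hJpos hs, hJpos ht, h⟩, s', t', hJpos hs', hJpos ht', h'⟩
  rw [this]
  exact MeasurableSet.iUnion fun k => ((hC k).image continuous_fst).isClosed.measurableSet

/-! ### General position -/

theorem exists_mem_greatCircle (x y : S2) : ∃ u : S2, x ∈ greatCircle u ∧ y ∈ greatCircle u := by
  let V := Submodule.span ℝ {(x : EuclideanSpace ℝ (Fin 3)), (y : EuclideanSpace ℝ (Fin 3))}
  have hV : Vᗮ ≠ ⊥ := by
    intro h
    have h1 := V.finrank_add_finrank_orthogonal
    have h2 : Module.finrank ℝ V ≤ 2 := by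
      have h := finrank_span_le_card (R := ℝ)
        ({(x : EuclideanSpace ℝ (Fin 3)), (y : EuclideanSpace ℝ (Fin 3))} : Set _)
      refine h.trans ?_
      rw [Set.toFinset_insert, Set.toFinset_singleton]
      exact Finset.card_le_two
    rw [h, finrank_bot, finrank_euclideanSpace_fin] at h1
    omega
  obtain ⟨w, hw, hw0⟩ := Submodule.exists_mem_ne_zero_of_ne_bot hV
  have hw' : ‖w‖ ≠ 0 := norm_ne_zero_iff.2 hw0
  rw [Submodule.mem_orthogonal'] at hw
  refine ⟨⟨‖w‖⁻¹ • w, by simp [norm_smul, hw']⟩, ?_, ?_⟩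
  · simp [greatCircle, inner_smul_left, hw x (Submodule.subset_span (by simp))]
  · simp [greatCircle, inner_smul_left, hw y (Submodule.subset_span (by simp))]

/-- Three independent random points with nondegenerate laws are almost surely linearly
independent. -/
theorem ae_linearIndependent_triple (μ ν ρ : Measure S2) [IsProbabilityMeasure μ]
    [IsProbabilityMeasure ν] [IsProbabilityMeasure ρ] (hν : Nondegenerate ν)
    (hρ : Nondegenerate ρ) :
    ∀ᵐ z ∂((μ.prod ν).prod ρ), LinearIndependent ℝ
      ![(z.1.1 : EuclideanSpace ℝ (Fin 3)), (z.1.2 : EuclideanSpace ℝ (Fin 3)),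
        (z.2 : EuclideanSpace ℝ (Fin 3))] := by
  have hmeas : MeasurableSet {z : (S2 × S2) × S2 | LinearIndependent ℝ
      ![(z.1.1 : EuclideanSpace ℝ (Fin 3)), (z.1.2 : EuclideanSpace ℝ (Fin 3)),
        (z.2 : EuclideanSpace ℝ (Fin 3))]} := by
    refine (isOpen_setOfPred_linearIndependent.preimage (f := fun z : (S2 × S2) × S2 =>
      ![(z.1.1 : EuclideanSpace ℝ (Fin 3)), (z.1.2 : EuclideanSpace ℝ (Fin 3)),
        (z.2 : EuclideanSpace ℝ (Fin 3))]) ?_).measurableSet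
    refine continuous_pi fun i => ?_
    fin_cases i
    · exact continuous_subtype_val.comp (continuous_fst.comp continuous_fst)
    · exact continuous_subtype_val.comp (continuous_snd.comp continuous_fst)
    · exact continuous_subtype_val.comp continuous_snd
  have hpair : ∀ᵐ p ∂(μ.prod ν), ∀ a b : ℝ,
      a • (p.1 : EuclideanSpace ℝ (Fin 3)) + b • (p.2 : EuclideanSpace ℝ (Fin 3)) = 0 →
        a = 0 ∧ b = 0 := by
    have hm : MeasurableSet {p : S2 × S2 | LinearIndependent ℝ
        ![(p.1 : EuclideanSpace ℝ (Fin 3)), (p.2 : EuclideanSpace ℝ (Fin 3))]} := by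
      refine (isOpen_setOfPred_linearIndependent.preimage (f := fun p : S2 × S2 =>
        ![(p.1 : EuclideanSpace ℝ (Fin 3)), (p.2 : EuclideanSpace ℝ (Fin 3))]) ?_).measurableSet
      refine continuous_pi fun i => ?_
      fin_cases i
      · exact continuous_subtype_val.comp continuous_fst
      · exact continuous_subtype_val.comp continuous_snd
    simp_rw [← LinearIndependent.pair_iff]
    refine (Measure.ae_prod_iff_ae_ae hm).2 (ae_of_all _ fun x => ?_)
    obtain ⟨u, hx, -⟩ := exists_mem_greatCircle x x
    filter_upwards [measure_eq_zero_iff_ae_notMem.1 (hν u)] with y hy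
    refine LinearIndependent.pair_iff.2 fun a b h => ?_
    have h1 := congrArg (inner ℝ (u : EuclideanSpace ℝ (Fin 3))) h
    simp only [greatCircle, Set.mem_ofPred_eq] at hx hy
    have hb : b = 0 := by simpa [inner_add_right, inner_smul_right, hx, hy] using h1
    subst hb
    have hx0 : (x : EuclideanSpace ℝ (Fin 3)) ≠ 0 := ne_zero_of_mem_unit_sphere x
    simpa [hx0] using h
  refine (Measure.ae_prod_iff_ae_ae hmeas).2 ?_
  filter_upwards [hpair] with p hp
  -- The normal `u` of a great circle through the first two points annihilates their terms in a
  -- relation, but not that of the third point.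
  obtain ⟨u, hx, hy⟩ := exists_mem_greatCircle p.1 p.2
  filter_upwards [measure_eq_zero_iff_ae_notMem.1 (hρ u)] with z hz
  refine Fintype.linearIndependent_iff.2 fun g hg => ?_
  simp only [Fin.sum_univ_three, Matrix.cons_val] at hg
  have h1 := congrArg (inner ℝ (u : EuclideanSpace ℝ (Fin 3))) hg
  simp only [greatCircle, Set.mem_ofPred_eq] at hx hy hz
  have h2 : g 2 = 0 := by simpa [inner_add_right, inner_smul_right, hx, hy, hz] using h1
  rw [h2, zero_smul, add_zero] at hg
  obtain ⟨h0, h1⟩ := hp _ _ hg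
  intro i
  fin_cases i
  exacts [h0, h1, h2]

/-- The ends of two edges are in general position: in a linear relation between the four points
(written with the two edges on different sides) either all coefficients vanish or none does. -/
def InGeneralPosition (z : (S2 × S2) × (S2 × S2)) : Prop :=
  ∀ c : Fin 4 → ℝ,
    c 0 • (z.1.1 : EuclideanSpace ℝ (Fin 3)) + c 1 • (z.1.2 : EuclideanSpace ℝ (Fin 3)) =
      c 2 • (z.2.1 : EuclideanSpace ℝ (Fin 3)) + c 3 • (z.2.2 : EuclideanSpace ℝ (Fin 3)) →
    ∀ i, c i = 0 → c = 0

theorem ae_inGeneralPosition (μ₁ μ₂ : Measure S2) [IsProbabilityMeasure μ₁]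
    [IsProbabilityMeasure μ₂] (hnd₁ : Nondegenerate μ₁) (hnd₂ : Nondegenerate μ₂) :
    ∀ᵐ z ∂((μ₁.prod μ₂).prod (μ₁.prod μ₂)), InGeneralPosition z := by
  have h3 := (((MeasurePreserving.id (μ₁.prod μ₂)).prod
    (measurePreserving_fst (μ := μ₁) (ν := μ₂))).quasiMeasurePreserving).ae
    (ae_linearIndependent_triple μ₁ μ₂ μ₁ hnd₂ hnd₁)
  have h2 := (((MeasurePreserving.id (μ₁.prod μ₂)).prod
    (measurePreserving_snd (μ := μ₁) (ν := μ₂))).quasiMeasurePreserving).ae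
    (ae_linearIndependent_triple μ₁ μ₂ μ₂ hnd₂ hnd₂)
  have hswap := (Measure.measurePreserving_swap (μ := μ₁.prod μ₂)
    (ν := μ₁.prod μ₂)).quasiMeasurePreserving
  filter_upwards [h2, h3, hswap.ae h2, hswap.ae h3] with z h2 h3 h0 h1
  simp only [Fintype.linearIndependent_iff, Fin.sum_univ_three, Matrix.cons_val, Prod.map_fst,
    Prod.map_snd, id_eq, Prod.fst_swap, Prod.snd_swap] at h0 h1 h2 h3
  intro c hc i hi
  fin_cases i <;> simp only [Fin.zero_eta, Fin.mk_one, Fin.reduceFinMk] at hi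
  · have h := h0 ![c 2, c 3, -c 1] (by simp [← hc, hi])
    have e0 := h 0
    have e1 := h 1
    have e2 := h 2
    simp only [Matrix.cons_val, neg_eq_zero] at e0 e1 e2
    funext j; fin_cases j <;> simp [*]
  · have h := h1 ![c 2, c 3, -c 0] (by simp [← hc, hi])
    have e0 := h 0
    have e1 := h 1
    have e2 := h 2
    simp only [Matrix.cons_val, neg_eq_zero] at e0 e1 e2
    funext j; fin_cases j <;> simp [*]
  · have h := h2 ![c 0, c 1, -c 3] (by simp [hc, hi])
    have e0 := h 0
    have e1 := h 1
    have e2 := h 2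
    simp only [Matrix.cons_val, neg_eq_zero] at e0 e1 e2
    funext j; fin_cases j <;> simp [*]
  · have h := h3 ![c 0, c 1, -c 2] (by simp [hc, hi])
    have e0 := h 0
    have e1 := h 1
    have e2 := h 2
    simp only [Matrix.cons_val, neg_eq_zero] at e0 e1 e2
    funext j; fin_cases j <;> simp [*]

/-- Any four vectors of `ℝ³` satisfy a nontrivial linear relation. -/
theorem exists_relation (z : (S2 × S2) × (S2 × S2)) : ∃ c : Fin 4 → ℝ, c ≠ 0 ∧
    c 0 • (z.1.1 : EuclideanSpace ℝ (Fin 3)) + c 1 • (z.1.2 : EuclideanSpace ℝ (Fin 3)) =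
      c 2 • (z.2.1 : EuclideanSpace ℝ (Fin 3)) + c 3 • (z.2.2 : EuclideanSpace ℝ (Fin 3)) := by
  have h : ¬ LinearIndependent ℝ
      ![(z.1.1 : EuclideanSpace ℝ (Fin 3)), (z.1.2 : EuclideanSpace ℝ (Fin 3)),
        -(z.2.1 : EuclideanSpace ℝ (Fin 3)), -(z.2.2 : EuclideanSpace ℝ (Fin 3))] := by
    intro h
    have := h.fintype_card_le_finrank
    simp at this
  obtain ⟨c, hc, i, hi⟩ := Fintype.not_linearIndependent_iff.1 h
  refine ⟨c, fun h0 => hi (by simp [h0]), ?_⟩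
  simp only [Fin.sum_univ_four, Matrix.cons_val, smul_neg] at hc
  refine sub_eq_zero.1 (Eq.trans ?_ hc)
  abel

/-! ### The crossing probability -/

/-- The point `x` or its antipode, according to a sign. -/
noncomputable def signFlip (ε : ℤˣ) (x : S2) : S2 := if ε = 1 then x else -x

theorem coe_signFlip (ε : ℤˣ) (x : S2) :
    (signFlip ε x : EuclideanSpace ℝ (Fin 3)) = ((ε : ℤ) : ℝ) • (x : EuclideanSpace ℝ (Fin 3)) := by
  rcases Int.units_eq_one_or ε with rfl | rfl <;> simp [signFlip]

theorem measurePreserving_signFlip {μ : Measure S2} (hμ : AntipodallySymmetric μ) (ε : ℤˣ) :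
    MeasurePreserving (signFlip ε) μ μ := by
  rcases Int.units_eq_one_or ε with rfl | rfl
  · have : signFlip 1 = id := by funext x; simp [signFlip]
    rw [this]
    exact MeasurePreserving.id μ
  · have : signFlip (-1) = fun x => -x := by funext x; simp [signFlip]
    rw [this]
    have hm : Measurable fun x : S2 => -x := continuous_neg.measurable
    refine ⟨hm, Measure.ext fun s hs => ?_⟩
    rw [Measure.map_apply hm hs, ← hμ s hs]
    congr 1
    ext x
    exact ⟨fun h => ⟨-x, h, neg_neg x⟩, by rintro ⟨y, hy, rfl⟩; simpa using hy⟩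

/-- Independent sign flips of the four ends of two edges. -/
noncomputable def signFlips (ε : Fin 4 → ℤˣ) : (S2 × S2) × (S2 × S2) → (S2 × S2) × (S2 × S2) :=
  Prod.map (Prod.map (signFlip (ε 0)) (signFlip (ε 1)))
    (Prod.map (signFlip (ε 2)) (signFlip (ε 3)))

/-- The sign of a real number, with the sign of `0` taken to be `-1`. -/
noncomputable def unitSign (r : ℝ) : ℤˣ := open Classical in if 0 < r then 1 else -1

theorem unitSign_of_pos {r : ℝ} (h : 0 < r) : unitSign r = 1 := by simp [unitSign, h]

theorem unitSign_of_neg {r : ℝ} (h : r < 0) : unitSign r = -1 := by simp [unitSign, h.le]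

theorem unitSign_mul_abs (r : ℝ) : ((unitSign r : ℤ) : ℝ) * |r| = r := by
  rcases lt_trichotomy r 0 with h | rfl | h
  · simp [unitSign_of_neg h, abs_of_neg h]
  · simp
  · simp [unitSign_of_pos h, abs_of_pos h]

theorem unitSign_mul_units {s : ℝ} (hs : 0 < s) (ε : ℤˣ) :
    unitSign (s * ((ε : ℤ) : ℝ)) = ε := by
  rcases Int.units_eq_one_or ε with rfl | rfl
  · simp [unitSign_of_pos hs]
  · simp [unitSign_of_neg (neg_lt_zero.2 hs)]

/-- For four points in general position with linear relation `c 0 a + c 1 b = c 2 a' + c 3 b'`,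
the flipped edges cross exactly when the signs of the flip agree with the signs of `c` up to a
common sign. -/
theorem crosses_signFlips_iff {z : (S2 × S2) × (S2 × S2)} (hz : InGeneralPosition z)
    {c : Fin 4 → ℝ} (hc0 : c ≠ 0)
    (hc : c 0 • (z.1.1 : EuclideanSpace ℝ (Fin 3)) + c 1 • (z.1.2 : EuclideanSpace ℝ (Fin 3)) =
      c 2 • (z.2.1 : EuclideanSpace ℝ (Fin 3)) + c 3 • (z.2.2 : EuclideanSpace ℝ (Fin 3)))
    (ε : Fin 4 → ℤˣ) :
    Crosses (signFlips ε z).1 (signFlips ε z).2 ↔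
      ε = (fun i => unitSign (c i)) ∨ ε = fun i => -unitSign (c i) := by
  have hne (i : Fin 4) : c i ≠ 0 := fun h => hc0 (hz c hc i h)
  constructor
  · rintro ⟨x, ⟨s, t, hs, ht, h⟩, s', t', hs', ht', h'⟩
    simp only [signFlips, Prod.map_fst, Prod.map_snd, coe_signFlip, smul_smul] at h h'
    let p : Fin 4 → ℝ := ![s, t, s', t']
    have hp (i : Fin 4) : 0 < p i := by fin_cases i <;> assumption
    let d : Fin 4 → ℝ := fun i => p i * ((ε i : ℤ) : ℝ)
    -- A relation is determined by its coefficient at `0`, so `d` is a multiple of `c`.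
    have hd : d = fun i => d 0 / c 0 * c i := by
      have h0 : (fun i => d i - d 0 / c 0 * c i) = 0 := by
        refine hz _ ?_ 0 (by simp [hne 0])
        have e : d 0 • (z.1.1 : EuclideanSpace ℝ (Fin 3)) + d 1 • (z.1.2 : EuclideanSpace ℝ (Fin 3))
            = d 2 • (z.2.1 : EuclideanSpace ℝ (Fin 3)) +
              d 3 • (z.2.2 : EuclideanSpace ℝ (Fin 3)) := h.symm.trans h'
        have e' := congrArg ((d 0 / c 0) • ·) hc
        simp only [smul_add, smul_smul] at e'
        have e'' := congrArg₂ (· - ·) e e'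
        simp only [sub_smul]
        rw [sub_add_sub_comm, sub_add_sub_comm]
        exact e''
      funext i
      exact sub_eq_zero.1 (congrFun h0 i)
    have hε (i : Fin 4) : ε i = unitSign (d 0 / c 0 * c i) := by
      rw [← congrFun hd i, unitSign_mul_units (hp i)]
    have hr : d 0 / c 0 ≠ 0 := by
      refine div_ne_zero (mul_ne_zero (hp 0).ne' ?_) (hne 0)
      rcases Int.units_eq_one_or (ε 0) with h | h <;> simp [h]
    rcases lt_or_gt_of_ne hr with hr | hr
    · right
      funext i
      rw [hε i]
      rcases lt_or_gt_of_ne (hne i) with h | h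
      · simp [unitSign_of_pos (mul_pos_of_neg_of_neg hr h), unitSign_of_neg h]
      · simp [unitSign_of_neg (mul_neg_of_neg_of_pos hr h), unitSign_of_pos h]
    · left
      funext i
      rw [hε i]
      simp [unitSign, hr]
  · intro h
    obtain ⟨η, hη⟩ : ∃ η : ℝ, ∀ i, |c i| * ((ε i : ℤ) : ℝ) = η * c i := by
      rcases h with rfl | rfl
      · exact ⟨1, fun i => by rw [mul_comm, unitSign_mul_abs, one_mul]⟩
      · exact ⟨-1, fun i => by
          push_cast
          rw [mul_neg, mul_comm, unitSign_mul_abs]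
          ring⟩
    have hη0 : η ≠ 0 := by
      rintro rfl
      have := hη 0
      rcases Int.units_eq_one_or (ε 0) with h | h <;> simp [h, hne 0] at this
    -- The crossing point is the normalization of the common value of the two sides.
    let x : EuclideanSpace ℝ (Fin 3) := (η * c 0) • (z.1.1 : EuclideanSpace ℝ (Fin 3)) +
      (η * c 1) • (z.1.2 : EuclideanSpace ℝ (Fin 3))
    have hx : x = (η * c 2) • (z.2.1 : EuclideanSpace ℝ (Fin 3)) +
        (η * c 3) • (z.2.2 : EuclideanSpace ℝ (Fin 3)) := by
      simp only [x, mul_smul, ← smul_add]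
      rw [hc]
    have hx0 : ‖x‖ ≠ 0 := by
      refine norm_ne_zero_iff.2 fun h0 => ?_
      have := hz ![η * c 0, η * c 1, 0, 0] (by simpa using h0) 2 rfl
      simpa [hη0, hne 0] using congrFun this 0
    have hpos : 0 < ‖x‖⁻¹ := inv_pos.2 (lt_of_le_of_ne (norm_nonneg x) hx0.symm)
    refine ⟨⟨‖x‖⁻¹ • x, by simp [norm_smul, hx0]⟩,
      ⟨‖x‖⁻¹ * |c 0|, ‖x‖⁻¹ * |c 1|, mul_pos hpos (abs_pos.2 (hne 0)),
        mul_pos hpos (abs_pos.2 (hne 1)), ?_⟩,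
      ⟨‖x‖⁻¹ * |c 2|, ‖x‖⁻¹ * |c 3|, mul_pos hpos (abs_pos.2 (hne 2)),
        mul_pos hpos (abs_pos.2 (hne 3)), ?_⟩⟩
    · simp only [signFlips, Prod.map_fst, Prod.map_snd, coe_signFlip, smul_smul, mul_assoc, hη]
      simp only [x, smul_add, smul_smul]
    · simp only [signFlips, Prod.map_fst, Prod.map_snd, coe_signFlip, smul_smul, mul_assoc, hη]
      simpa only [smul_add, smul_smul] using congrArg (‖x‖⁻¹ • ·) hx

open Classical in
/-- Exactly two of the sixteen sign flips of four points in general position make the two edges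
cross. -/
theorem sum_signFlips_crosses {z : (S2 × S2) × (S2 × S2)} (hz : InGeneralPosition z) :
    ∑ ε : Fin 4 → ℤˣ, {w : (S2 × S2) × (S2 × S2) | Crosses w.1 w.2}.indicator
      (fun _ => (1 : ℝ)) (signFlips ε z) = 2 := by
  obtain ⟨c, hc0, hc⟩ := exists_relation z
  simp only [Set.indicator_apply, Set.mem_ofPred_eq, crosses_signFlips_iff hz hc0 hc]
  rw [Finset.sum_boole]
  have : (Finset.univ.filter fun ε : Fin 4 → ℤˣ =>
      ε = (fun i => unitSign (c i)) ∨ ε = fun i => -unitSign (c i)) =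
      {(fun i => unitSign (c i)), fun i => -unitSign (c i)} := by
    ext ε
    simp
  rw [this, Finset.card_pair]
  · norm_num
  · intro h
    exact units_ne_neg_self _ (congrFun h 0)

/-- Two independent random edges cross with probability `1/8`. -/
theorem measureReal_crosses (μ₁ μ₂ : Measure S2) [IsProbabilityMeasure μ₁]
    [IsProbabilityMeasure μ₂] (hnd₁ : Nondegenerate μ₁) (hnd₂ : Nondegenerate μ₂)
    (has₁ : AntipodallySymmetric μ₁) (has₂ : AntipodallySymmetric μ₂) :
    ((μ₁.prod μ₂).prod (μ₁.prod μ₂)).real {z | Crosses z.1 z.2} = 1 / 8 := by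
  set M := (μ₁.prod μ₂).prod (μ₁.prod μ₂)
  set S := {z : (S2 × S2) × (S2 × S2) | Crosses z.1 z.2}
  have hS : MeasurableSet S := measurableSet_crosses
  have hflip (ε : Fin 4 → ℤˣ) : MeasurePreserving (signFlips ε) M M :=
    ((measurePreserving_signFlip has₁ (ε 0)).prod (measurePreserving_signFlip has₂ (ε 1))).prod
      ((measurePreserving_signFlip has₁ (ε 2)).prod (measurePreserving_signFlip has₂ (ε 3)))
  have hind : Integrable (S.indicator fun _ => (1 : ℝ)) M :=
    (integrable_const (1 : ℝ)).indicator hS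
  have h1 : ∫ z, ∑ ε : Fin 4 → ℤˣ, S.indicator (fun _ => (1 : ℝ)) (signFlips ε z) ∂M = 2 := by
    rw [integral_congr_ae (g := fun _ => (2 : ℝ))]
    · simp
    · filter_upwards [ae_inGeneralPosition μ₁ μ₂ hnd₁ hnd₂] with z hz
      exact sum_signFlips_crosses hz
  have h2 (ε : Fin 4 → ℤˣ) :
      ∫ z, S.indicator (fun _ => (1 : ℝ)) (signFlips ε z) ∂M = M.real S := by
    rw [← integral_map (hflip ε).measurable.aemeasurable
      ((measurable_const.indicator hS).aestronglyMeasurable), (hflip ε).map_eq]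
    simp [integral_indicator hS]
  rw [integral_finsetSum (f := fun ε z => S.indicator (fun _ => (1 : ℝ)) (signFlips ε z)) _
    fun ε _ => (hflip ε).integrable_comp_of_integrable hind] at h1
  simp only [h2, Finset.sum_const, Finset.card_univ, nsmul_eq_mul] at h1
  have hcard : Fintype.card (Fin 4 → ℤˣ) = 16 := by simp
  rw [hcard] at h1
  norm_num at h1
  linarith

/-! ### Homomorphism densities of the crossing relation -/

/-- The tuples of edges, indexed by the vertices of `H`, for which adjacency in `H` implies
crossing. -/
def crossingHomSet {V : Type*} (H : SimpleGraph V) : Set (V → S2 × S2) :=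
  {y | ∀ v w, H.Adj v w → Crosses (y v) (y w)}

theorem measurableSet_crossingHomSet {V : Type*} [Countable V] (H : SimpleGraph V) :
    MeasurableSet (crossingHomSet H) := by
  have : crossingHomSet H = ⋂ (v) (w) (_ : H.Adj v w),
      (fun y : V → S2 × S2 => (y v, y w)) ⁻¹' {z | Crosses z.1 z.2} := by
    ext y
    simp [crossingHomSet]
  rw [this]
  exact MeasurableSet.iInter fun v => MeasurableSet.iInter fun w => MeasurableSet.iInter fun _ =>
    measurableSet_crosses.preimage ((measurable_pi_apply v).prodMk (measurable_pi_apply w))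

/-- The density of `H` in the crossing relation: the probability that independent random edges,
one for each vertex of `H`, cross whenever the vertices are adjacent. -/
noncomputable def crossingDensity {V : Type*} [Fintype V] (μ₁ μ₂ : Measure S2)
    (H : SimpleGraph V) : ℝ :=
  (Measure.pi fun _ : V => μ₁.prod μ₂).real (crossingHomSet H)

theorem crossingDensity_top_two (μ₁ μ₂ : Measure S2) [IsProbabilityMeasure μ₁]
    [IsProbabilityMeasure μ₂] (hnd₁ : Nondegenerate μ₁) (hnd₂ : Nondegenerate μ₂)
    (has₁ : AntipodallySymmetric μ₁) (has₂ : AntipodallySymmetric μ₂) :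
    crossingDensity μ₁ μ₂ (⊤ : SimpleGraph (Fin 2)) = 1 / 8 := by
  rw [← measureReal_crosses μ₁ μ₂ hnd₁ hnd₂ has₁ has₂,
    ← (measurePreserving_finTwoArrow (μ₁.prod μ₂)).measureReal_preimage
      measurableSet_crosses.nullMeasurableSet, crossingDensity]
  congr 1
  ext y
  simp only [crossingHomSet, SimpleGraph.top_adj, Fin.forall_fin_two, Set.mem_ofPred_eq,
    Set.mem_preimage, MeasurableEquiv.finTwoArrow_apply]
  constructor
  · exact fun h => h.1.2 (by simp)
  · exact fun h => ⟨⟨by simp, fun _ => h⟩, fun _ => h.symm, by simp⟩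

/-- The graphon of the crossing relation, after transporting the law of a random edge to the unit
interval along `f`. -/
noncomputable def crossingGraphon (f : I → S2 × S2) (hf : Measurable f) : Graphon where
  toFun x y := {z : (S2 × S2) × (S2 × S2) | Crosses z.1 z.2}.indicator (fun _ => 1) (f x, f y)
  measurable_toFun := (measurable_const.indicator measurableSet_crosses).comp
    (by fun_prop : Measurable fun p : I × I => (f p.1, f p.2))
  symm x y := by
    classical
    have : Crosses (f x) (f y) ↔ Crosses (f y) (f x) := ⟨Crosses.symm, Crosses.symm⟩
    simp [Set.indicator_apply, this]
  mem_Icc x y := by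
    classical
    rw [Set.indicator_apply]
    split_ifs <;> simp

theorem crossingGraphon_edgeValue {f : I → S2 × S2} (hf : Measurable f) {V : Type*} (x : V → I)
    (v w : V) : (crossingGraphon f hf).edgeValue x s(v, w) =
      {z : (S2 × S2) × (S2 × S2) | Crosses z.1 z.2}.indicator (fun _ => (1 : ℝ))
        (f (x v), f (x w)) :=
  rfl

open Classical in
theorem prod_edgeValue_crossingGraphon {f : I → S2 × S2} (hf : Measurable f) {V : Type*}
    [Fintype V] (H : SimpleGraph V) (x : V → I) :
    ∏ e ∈ H.edgeFinset, (crossingGraphon f hf).edgeValue x e =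
      (crossingHomSet H).indicator (fun _ => (1 : ℝ)) (fun v => f (x v)) := by
  by_cases h : (fun v => f (x v)) ∈ crossingHomSet H
  · rw [Set.indicator_of_mem h]
    refine Finset.prod_eq_one fun e he => ?_
    induction e using Sym2.ind with
    | _ v w =>
      have hvw : H.Adj v w := by
        rwa [SimpleGraph.mem_edgeFinset, SimpleGraph.mem_edgeSet] at he
      rw [crossingGraphon_edgeValue, Set.indicator_apply, if_pos]
      exact h v w hvw
  · rw [Set.indicator_of_notMem h]
    simp only [crossingHomSet, Set.mem_ofPred_eq, not_forall] at h
    obtain ⟨v, w, hvw, hc⟩ := h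
    refine Finset.prod_eq_zero (i := s(v, w)) ?_ ?_
    · rw [SimpleGraph.mem_edgeFinset, SimpleGraph.mem_edgeSet]
      exact hvw
    · rw [crossingGraphon_edgeValue, Set.indicator_apply, if_neg]
      exact hc

theorem homDensity_crossingGraphon (μ₁ μ₂ : Measure S2) [IsProbabilityMeasure μ₁]
    [IsProbabilityMeasure μ₂] {f : I → S2 × S2} (hf : Measurable f)
    (hmap : volume.map f = μ₁.prod μ₂) {V : Type*} [Fintype V] (H : SimpleGraph V) :
    (crossingGraphon f hf).homDensity H = crossingDensity μ₁ μ₂ H := by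
  have hmp : MeasurePreserving (fun (x : V → I) v => f (x v)) volume
      (Measure.pi fun _ => μ₁.prod μ₂) :=
    measurePreserving_pi (fun _ => volume) (fun _ => μ₁.prod μ₂) fun _ => ⟨hf, hmap⟩
  have hm := measurableSet_crossingHomSet H
  calc (crossingGraphon f hf).homDensity H
      = ∫ x : V → I, (crossingHomSet H).indicator (fun _ => (1 : ℝ)) (fun v => f (x v)) := by
        unfold Graphon.homDensity
        simp_rw [prod_edgeValue_crossingGraphon]
    _ = ∫ y, (crossingHomSet H).indicator (fun _ => (1 : ℝ)) y
          ∂(Measure.pi fun _ => μ₁.prod μ₂) := by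
        rw [← hmp.map_eq, integral_map hmp.measurable.aemeasurable
          (measurable_const.indicator hm).aestronglyMeasurable]
    _ = crossingDensity μ₁ μ₂ H := by
        rw [integral_indicator hm]
        simp [crossingDensity]

/-! ### Homomorphism densities of crossing graphs -/

/-- The edges of the drawing with ends `z` selected by `φ`. -/
def selectEdges {k n : ℕ} (φ : Fin k → Fin n × Fin n) (z : Fin n → S2 × S2) : Fin k → S2 × S2 :=
  fun v => ((z (φ v).1).1, (z (φ v).2).2)

/-- The drawings, given by the pairs of points `(a i, b i)`, for which `φ` is a homomorphism from
`H` to the crossing graph. -/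
def homEvent {k n : ℕ} (H : SimpleGraph (Fin k)) (φ : Fin k → Fin n × Fin n) :
    Set (Fin n → S2 × S2) :=
  {z | (∀ v w, H.Adj v w → φ v ≠ φ w) ∧ selectEdges φ z ∈ crossingHomSet H}

theorem measurable_selectEdges {k n : ℕ} (φ : Fin k → Fin n × Fin n) :
    Measurable (selectEdges φ) := by
  unfold selectEdges
  fun_prop

theorem measurableSet_homEvent {k n : ℕ} (H : SimpleGraph (Fin k)) (φ : Fin k → Fin n × Fin n) :
    MeasurableSet (homEvent H φ) :=
  (MeasurableSet.const _).inter ((measurableSet_crossingHomSet H).preimage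
    (measurable_selectEdges φ))

/-- The density of `H` in the crossing graph of the drawing given by the pairs `(a i, b i)`. -/
noncomputable def drawingDensity {k n : ℕ} (H : SimpleGraph (Fin k)) (z : Fin n → S2 × S2) : ℝ :=
  graphHomDensity H (crossingGraph (fun i => (z i).1) fun i => (z i).2)

theorem drawingDensity_eq_sum {k n : ℕ} (H : SimpleGraph (Fin k)) (z : Fin n → S2 × S2) :
    drawingDensity H z = (∑ φ : Fin k → Fin n × Fin n,
      (homEvent H φ).indicator (fun _ => (1 : ℝ)) z) / ((n * n : ℕ) : ℝ) ^ k := by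
  classical
  have hcard : Nat.card (H →g crossingGraph (fun i => (z i).1) fun i => (z i).2) =
      (Finset.univ.filter fun φ : Fin k → Fin n × Fin n => z ∈ homEvent H φ).card := by
    rw [← Fintype.card_subtype, ← Nat.card_eq_fintype_card]
    refine Nat.card_congr
      { toFun := fun g => ⟨g, fun v w h => (g.map_rel h).1, fun v w h => (g.map_rel h).2⟩
        invFun := fun φ => ⟨φ.1, fun {v w} h => ⟨φ.2.1 v w h, φ.2.2 v w h⟩⟩
        left_inv := fun g => rfl
        right_inv := fun φ => rfl }
  simp only [drawingDensity, graphHomDensity, hcard, Set.indicator_apply, Finset.sum_boole]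
  simp

theorem drawingDensity_mem_Icc {k n : ℕ} (H : SimpleGraph (Fin k)) (z : Fin n → S2 × S2) :
    drawingDensity H z ∈ Set.Icc (0 : ℝ) 1 := by
  classical
  rw [drawingDensity_eq_sum]
  refine ⟨div_nonneg (Finset.sum_nonneg fun φ _ => Set.indicator_nonneg (by simp) _)
    (by positivity), div_le_one_of_le₀ ?_ (by positivity)⟩
  refine (Finset.sum_le_card_nsmul _ _ 1 fun φ _ => ?_).trans (by simp)
  exact Set.indicator_le_self' (by simp) _

theorem measurable_drawingDensity {k n : ℕ} (H : SimpleGraph (Fin k)) :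
    Measurable fun z : Fin n → S2 × S2 => drawingDensity H z := by
  simp_rw [drawingDensity_eq_sum]
  exact (Finset.measurable_sum _ fun φ _ =>
    measurable_const.indicator (measurableSet_homEvent H φ)).div_const _

/-! ### Counting -/

/-- A set of tuples of pairs in which the first entry of the pair at `v` is determined by all other
entries has proportion at most `1 / n`. -/
theorem card_mul_le_of_fst_determined {k n : ℕ} (v : Fin k)
    (S : Finset (Fin k → Fin n × Fin n))
    (hS : ∀ φ ∈ S, ∀ ψ ∈ S, (∀ w, w ≠ v → φ w = ψ w) → (φ v).2 = (ψ v).2 → (φ v).1 = (ψ v).1) :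
    n * S.card ≤ (n * n) ^ k := by
  have h := Finset.card_le_card_of_injOn (s := (Finset.univ : Finset (Fin n)) ×ˢ S)
    (t := (Finset.univ : Finset (Fin k → Fin n × Fin n)))
    (fun p => Function.update p.2 v (p.1, (p.2 v).2)) (by simp) ?_
  · simpa using h
  · rintro ⟨i, φ⟩ hφ ⟨j, ψ⟩ hψ heq
    simp only [Finset.coe_product, Set.mem_prod, Finset.mem_coe] at hφ hψ
    have hv := congrFun heq v
    simp only [Function.update_self, Prod.mk.injEq] at hv
    have hw (w : Fin k) (hw : w ≠ v) : φ w = ψ w := by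
      simpa [hw] using congrFun heq w
    refine Prod.ext hv.1 (funext fun w => ?_)
    by_cases hwv : w = v
    · subst hwv
      exact Prod.ext (hS φ hφ.2 ψ hψ.2 hw hv.2) hv.2
    · exact hw w hwv

theorem card_mul_le_of_snd_determined {k n : ℕ} (v : Fin k)
    (S : Finset (Fin k → Fin n × Fin n))
    (hS : ∀ φ ∈ S, ∀ ψ ∈ S, (∀ w, w ≠ v → φ w = ψ w) → (φ v).1 = (ψ v).1 → (φ v).2 = (ψ v).2) :
    n * S.card ≤ (n * n) ^ k := by
  classical
  let e : (Fin k → Fin n × Fin n) ↪ (Fin k → Fin n × Fin n) :=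
    ⟨fun φ w => (φ w).swap, fun φ ψ h => funext fun w => Prod.swap_injective (congrFun h w)⟩
  have h := card_mul_le_of_fst_determined v (S.map e) ?_
  · simpa using h
  · intro φ' hφ ψ' hψ
    obtain ⟨φ, hφS, rfl⟩ := Finset.mem_map.1 hφ
    obtain ⟨ψ, hψS, rfl⟩ := Finset.mem_map.1 hψ
    exact fun h h' => hS φ hφS ψ hψS (fun w hw => Prod.swap_injective (h w hw)) h'

open Classical in
theorem card_mul_filter_index_le {k n : ℕ} (i : Fin n) :
    n * (Finset.univ.filter fun φ : Fin k → Fin n × Fin n =>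
      ∃ v, (φ v).1 = i ∨ (φ v).2 = i).card ≤ 2 * k * (n * n) ^ k := by
  let S (v : Fin k) := Finset.univ.filter fun φ : Fin k → Fin n × Fin n => (φ v).1 = i
  let T (v : Fin k) := Finset.univ.filter fun φ : Fin k → Fin n × Fin n => (φ v).2 = i
  have hsub : (Finset.univ.filter fun φ : Fin k → Fin n × Fin n =>
      ∃ v, (φ v).1 = i ∨ (φ v).2 = i) ⊆ Finset.univ.biUnion fun v => S v ∪ T v := by
    intro φ
    simp [S, T]
  calc n * _ ≤ n * ∑ v : Fin k, ((S v).card + (T v).card) :=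
        Nat.mul_le_mul_left _ ((Finset.card_le_card hsub).trans
          (Finset.card_biUnion_le.trans (Finset.sum_le_sum fun v _ => Finset.card_union_le _ _)))
    _ = ∑ v : Fin k, (n * (S v).card + n * (T v).card) := by
        rw [Finset.mul_sum]
        simp_rw [mul_add]
    _ ≤ ∑ v : Fin k, ((n * n) ^ k + (n * n) ^ k) := by
        refine Finset.sum_le_sum fun v _ => add_le_add ?_ ?_
        · refine card_mul_le_of_fst_determined v _ fun φ hφ ψ hψ _ _ => ?_
          simp only [S, Finset.mem_filter, Finset.mem_univ, true_and] at hφ hψ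
          rw [hφ, hψ]
        · refine card_mul_le_of_snd_determined v _ fun φ hφ ψ hψ _ _ => ?_
          simp only [T, Finset.mem_filter, Finset.mem_univ, true_and] at hφ hψ
          rw [hφ, hψ]
    _ = 2 * k * (n * n) ^ k := by
        simp only [Finset.sum_const, Finset.card_univ, Fintype.card_fin, smul_eq_mul]
        ring

open Classical in
theorem card_mul_filter_not_injective_le {k n : ℕ} :
    n * (Finset.univ.filter fun φ : Fin k → Fin n × Fin n =>
      ¬ ((fun v => (φ v).1).Injective ∧ (fun v => (φ v).2).Injective)).card ≤
      2 * k ^ 2 * (n * n) ^ k := by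
  let S (p : Fin k × Fin k) := Finset.univ.filter fun φ : Fin k → Fin n × Fin n =>
    p.1 ≠ p.2 ∧ (φ p.1).1 = (φ p.2).1
  let T (p : Fin k × Fin k) := Finset.univ.filter fun φ : Fin k → Fin n × Fin n =>
    p.1 ≠ p.2 ∧ (φ p.1).2 = (φ p.2).2
  have hsub : (Finset.univ.filter fun φ : Fin k → Fin n × Fin n =>
      ¬ ((fun v => (φ v).1).Injective ∧ (fun v => (φ v).2).Injective)) ⊆
      Finset.univ.biUnion fun p => S p ∪ T p := by
    intro φ
    simp only [Finset.mem_filter, Finset.mem_univ, true_and, Finset.mem_biUnion, Finset.mem_union,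
      S, T, not_and_or, Function.Injective, not_forall]
    rintro (⟨v, w, h, hne⟩ | ⟨v, w, h, hne⟩)
    · exact ⟨(v, w), Or.inl ⟨hne, h⟩⟩
    · exact ⟨(v, w), Or.inr ⟨hne, h⟩⟩
  calc n * _ ≤ n * ∑ p : Fin k × Fin k, ((S p).card + (T p).card) :=
        Nat.mul_le_mul_left _ ((Finset.card_le_card hsub).trans
          (Finset.card_biUnion_le.trans (Finset.sum_le_sum fun v _ => Finset.card_union_le _ _)))
    _ = ∑ p : Fin k × Fin k, (n * (S p).card + n * (T p).card) := by
        rw [Finset.mul_sum]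
        simp_rw [mul_add]
    _ ≤ ∑ p : Fin k × Fin k, ((n * n) ^ k + (n * n) ^ k) := by
        refine Finset.sum_le_sum fun p _ => add_le_add ?_ ?_
        · refine card_mul_le_of_fst_determined p.1 _ fun φ hφ ψ hψ h _ => ?_
          simp only [S, Finset.mem_filter, Finset.mem_univ, true_and] at hφ hψ
          rw [hφ.2, hψ.2, h p.2 hφ.1.symm]
        · refine card_mul_le_of_snd_determined p.1 _ fun φ hφ ψ hψ h _ => ?_
          simp only [T, Finset.mem_filter, Finset.mem_univ, true_and] at hφ hψ
          rw [hφ.2, hψ.2, h p.2 hφ.1.symm]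
    _ = 2 * k ^ 2 * (n * n) ^ k := by
        simp only [Finset.sum_const, Finset.card_univ, Fintype.card_prod, Fintype.card_fin,
          smul_eq_mul]
        ring

/-! ### Expectation and concentration of the homomorphism densities -/

/-- If `φ` uses no point twice, then the selected edges are independent. -/
theorem measurePreserving_selectEdges (μ₁ μ₂ : Measure S2) [IsProbabilityMeasure μ₁]
    [IsProbabilityMeasure μ₂] {k n : ℕ} {φ : Fin k → Fin n × Fin n}
    (h₁ : (fun v => (φ v).1).Injective) (h₂ : (fun v => (φ v).2).Injective) :
    MeasurePreserving (selectEdges φ) (Measure.pi fun _ => μ₁.prod μ₂)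
      (Measure.pi fun _ => μ₁.prod μ₂) :=
  (measurePreserving_arrowProdEquivProdArrow S2 S2 (Fin k) (fun _ => μ₁) fun _ => μ₂).symm.comp
    (((measurePreserving_pi_precomp μ₁ h₁).prod (measurePreserving_pi_precomp μ₂ h₂)).comp
      (measurePreserving_arrowProdEquivProdArrow S2 S2 (Fin n) (fun _ => μ₁) fun _ => μ₂))

theorem measureReal_homEvent (μ₁ μ₂ : Measure S2) [IsProbabilityMeasure μ₁]
    [IsProbabilityMeasure μ₂] {k n : ℕ} (H : SimpleGraph (Fin k)) {φ : Fin k → Fin n × Fin n}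
    (h₁ : (fun v => (φ v).1).Injective) (h₂ : (fun v => (φ v).2).Injective) :
    (Measure.pi fun _ => μ₁.prod μ₂).real (homEvent H φ) = crossingDensity μ₁ μ₂ H := by
  have : homEvent H φ = selectEdges φ ⁻¹' crossingHomSet H := by
    ext z
    exact ⟨fun h => h.2, fun h => ⟨fun v w hvw heq => hvw.ne (h₁ (congrArg Prod.fst heq)), h⟩⟩
  rw [this, (measurePreserving_selectEdges μ₁ μ₂ h₁ h₂).measureReal_preimage
    (measurableSet_crossingHomSet H).nullMeasurableSet, crossingDensity]

/-- The expected density differs from the limit only through the maps that use some point twice. -/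
theorem abs_integral_drawingDensity_sub_le (μ₁ μ₂ : Measure S2) [IsProbabilityMeasure μ₁]
    [IsProbabilityMeasure μ₂] {k n : ℕ} (hn : n ≠ 0) (H : SimpleGraph (Fin k)) :
    |∫ z : Fin n → S2 × S2, drawingDensity H z ∂(Measure.pi fun _ => μ₁.prod μ₂) -
      crossingDensity μ₁ μ₂ H| ≤ 2 * k ^ 2 / n := by
  classical
  set M := Measure.pi fun _ : Fin n => μ₁.prod μ₂
  set τ := crossingDensity μ₁ μ₂ H
  have hn' : (0 : ℝ) < n := by exact_mod_cast Nat.pos_of_ne_zero hn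
  have hN : (0 : ℝ) < ((n * n : ℕ) : ℝ) ^ k := by positivity
  have hint : ∫ z : Fin n → S2 × S2, drawingDensity H z ∂M =
      (∑ φ : Fin k → Fin n × Fin n, M.real (homEvent H φ)) / ((n * n : ℕ) : ℝ) ^ k := by
    simp_rw [drawingDensity_eq_sum]
    rw [integral_div, integral_finsetSum _ fun φ _ =>
      (integrable_const (1 : ℝ)).indicator (measurableSet_homEvent H φ)]
    congr 1
    refine Finset.sum_congr rfl fun φ _ => ?_
    rw [integral_indicator (measurableSet_homEvent H φ)]
    simp
  have hsum : ∑ φ : Fin k → Fin n × Fin n, τ = ((n * n : ℕ) : ℝ) ^ k * τ := by simp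
  have hdiff : ∫ z : Fin n → S2 × S2, drawingDensity H z ∂M - τ =
      (∑ φ : Fin k → Fin n × Fin n, (M.real (homEvent H φ) - τ)) / ((n * n : ℕ) : ℝ) ^ k := by
    rw [hint, Finset.sum_sub_distrib, hsum]
    field_simp
  let p (φ : Fin k → Fin n × Fin n) : Prop :=
    (fun v => (φ v).1).Injective ∧ (fun v => (φ v).2).Injective
  have hterm (φ : Fin k → Fin n × Fin n) :
      |M.real (homEvent H φ) - τ| ≤ if ¬ p φ then 1 else 0 := by
    by_cases h : p φ
    · rw [measureReal_homEvent μ₁ μ₂ H h.1 h.2]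
      simp [τ, h]
    · rw [if_pos h]
      have h1 : M.real (homEvent H φ) ≤ 1 := measureReal_le_one
      have h2 : τ ≤ 1 := measureReal_le_one
      have h3 : 0 ≤ M.real (homEvent H φ) := measureReal_nonneg
      have h4 : 0 ≤ τ := measureReal_nonneg
      exact abs_le.2 ⟨by linarith, by linarith⟩
  have hcount : (n : ℝ) * (Finset.univ.filter fun φ : Fin k → Fin n × Fin n => ¬ p φ).card ≤
      2 * k ^ 2 * ((n * n : ℕ) : ℝ) ^ k := by
    exact_mod_cast card_mul_filter_not_injective_le (k := k) (n := n)
  rw [hdiff, abs_div, abs_of_pos hN, div_le_div_iff₀ hN hn']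
  calc |∑ φ : Fin k → Fin n × Fin n, (M.real (homEvent H φ) - τ)| * n
      ≤ (∑ φ : Fin k → Fin n × Fin n, if ¬ p φ then (1 : ℝ) else 0) * n :=
        mul_le_mul_of_nonneg_right ((Finset.abs_sum_le_sum_abs _ _).trans
          (Finset.sum_le_sum fun φ _ => hterm φ)) hn'.le
    _ ≤ 2 * k ^ 2 * ((n * n : ℕ) : ℝ) ^ k := by
        rw [Finset.sum_boole, mul_comm]
        exact hcount

/-- Moving the two points of index `i` affects only the maps that use the index `i`. -/
theorem abs_drawingDensity_update_sub_le {k n : ℕ} (H : SimpleGraph (Fin k))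
    (z : Fin n → S2 × S2) (i : Fin n) (y : S2 × S2) :
    |drawingDensity H (Function.update z i y) - drawingDensity H z| ≤ 2 * k / n := by
  classical
  have hn' : (0 : ℝ) < n := by exact_mod_cast i.pos
  have hN : (0 : ℝ) < ((n * n : ℕ) : ℝ) ^ k := by
    have : 0 < n := i.pos
    positivity
  let p (φ : Fin k → Fin n × Fin n) : Prop := ∃ v, (φ v).1 = i ∨ (φ v).2 = i
  have hterm (φ : Fin k → Fin n × Fin n) :
      |(homEvent H φ).indicator (fun _ => (1 : ℝ)) (Function.update z i y) -
        (homEvent H φ).indicator (fun _ => (1 : ℝ)) z| ≤ if p φ then 1 else 0 := by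
    split_ifs with h
    · simp only [Set.indicator_apply]
      split_ifs <;> simp
    · have hsel : selectEdges φ (Function.update z i y) = selectEdges φ z := by
        funext v
        simp only [p, not_exists, not_or] at h
        simp [selectEdges, (h v).1, (h v).2]
      have : Function.update z i y ∈ homEvent H φ ↔ z ∈ homEvent H φ := by
        simp only [homEvent, Set.mem_ofPred_eq, hsel]
      simp [Set.indicator_apply, this]
  have hcount : (n : ℝ) * (Finset.univ.filter fun φ : Fin k → Fin n × Fin n => p φ).card ≤
      2 * k * ((n * n : ℕ) : ℝ) ^ k := by
    exact_mod_cast card_mul_filter_index_le (k := k) i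
  rw [drawingDensity_eq_sum, drawingDensity_eq_sum, ← sub_div, ← Finset.sum_sub_distrib, abs_div,
    abs_of_pos hN, div_le_div_iff₀ hN hn']
  calc _ ≤ (∑ φ : Fin k → Fin n × Fin n, if p φ then (1 : ℝ) else 0) * n :=
        mul_le_mul_of_nonneg_right ((Finset.abs_sum_le_sum_abs _ _).trans
          (Finset.sum_le_sum fun φ _ => hterm φ)) hn'.le
    _ ≤ 2 * k * ((n * n : ℕ) : ℝ) ^ k := by
        rw [Finset.sum_boole, mul_comm]
        exact hcount

theorem measure_le_abs_drawingDensity_sub (μ₁ μ₂ : Measure S2) [IsProbabilityMeasure μ₁]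
    [IsProbabilityMeasure μ₂] {k n : ℕ} (H : SimpleGraph (Fin k)) {δ : ℝ} (hδ : 0 ≤ δ) :
    (Measure.pi fun _ : Fin n => μ₁.prod μ₂)
      {z | δ ≤ |drawingDensity H z - ∫ z' : Fin n → S2 × S2, drawingDensity H z'
        ∂(Measure.pi fun _ => μ₁.prod μ₂)|}
      ≤ ENNReal.ofReal (2 * Real.exp (n * -(δ ^ 2 / (8 * (k + 1) ^ 2)))) := by
  set M := Measure.pi fun _ : Fin n => μ₁.prod μ₂
  set m := ∫ z' : Fin n → S2 × S2, drawingDensity H z' ∂M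
  -- The constant `2 (k + 1) / n`, rather than `2 k / n`, is positive also when `k = 0`.
  let c : NNReal := 2 * (k + 1) / n
  have hsub : HasSubgaussianMGF (fun z => drawingDensity H z - m) (n * c ^ 2) M := by
    refine hasSubgaussianMGF_pi_of_bounded_differences (μ₁.prod μ₂) (measurable_drawingDensity H)
      (drawingDensity_mem_Icc H) fun z i y =>
      (abs_drawingDensity_update_sub_le H z i y).trans ?_
    simp only [c]
    push_cast
    gcongr
    linarith
  have hexp : -δ ^ 2 / (2 * ((n * c ^ 2 : NNReal) : ℝ)) = n * -(δ ^ 2 / (8 * (k + 1) ^ 2)) := by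
    simp only [c]
    push_cast
    rcases eq_or_ne n 0 with rfl | hn
    · simp
    · have : (n : ℝ) ≠ 0 := by exact_mod_cast hn
      field_simp
      ring
  have h1 := hsub.measure_ge_le hδ
  have h2 := hsub.neg.measure_ge_le hδ
  rw [hexp] at h1 h2
  have hle : M.real {z | δ ≤ |drawingDensity H z - m|} ≤
      2 * Real.exp (n * -(δ ^ 2 / (8 * (k + 1) ^ 2))) := by
    calc M.real {z | δ ≤ |drawingDensity H z - m|}
        ≤ M.real ({z | δ ≤ drawingDensity H z - m} ∪
            {z | δ ≤ (-fun z => drawingDensity H z - m) z}) :=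
          measureReal_mono fun z hz => by
            simp only [Set.mem_union, Set.mem_ofPred_eq, Pi.neg_apply] at hz ⊢
            exact le_abs.1 hz
      _ ≤ _ := (measureReal_union_le _ _).trans (by linarith)
  rw [← ofReal_measureReal]
  exact ENNReal.ofReal_le_ofReal hle

theorem tendsto_integral_drawingDensity (μ₁ μ₂ : Measure S2) [IsProbabilityMeasure μ₁]
    [IsProbabilityMeasure μ₂] {k : ℕ} (H : SimpleGraph (Fin k)) :
    Tendsto (fun n : ℕ => ∫ z : Fin n → S2 × S2, drawingDensity H z
      ∂(Measure.pi fun _ => μ₁.prod μ₂)) atTop (𝓝 (crossingDensity μ₁ μ₂ H)) := by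
  rw [tendsto_iff_norm_sub_tendsto_zero]
  refine squeeze_zero' (Eventually.of_forall fun n => norm_nonneg _) ?_
    (tendsto_const_div_atTop_nhds_zero_nat (2 * (k : ℝ) ^ 2))
  filter_upwards [eventually_ne_atTop 0] with n hn
  exact abs_integral_drawingDensity_sub_le μ₁ μ₂ hn H

/-- By Borel–Cantelli, the exponential tail bounds give almost sure convergence whatever the joint
law of the drawings for different `n`. -/
theorem ae_tendsto_graphHomDensity {Ω : Type u} [MeasurableSpace Ω] (μ₁ μ₂ : Measure S2)
    [IsProbabilityMeasure μ₁] [IsProbabilityMeasure μ₂] (P : Measure Ω)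
    {A B : ∀ n : ℕ, Ω → Fin n → S2}
    (hAB : IsRandomDrawingSequence μ₁ μ₂ P A B) {k : ℕ} (H : SimpleGraph (Fin k)) :
    ∀ᵐ ω ∂P, Tendsto (fun n => graphHomDensity H (crossingGraph (A n ω) (B n ω))) atTop
      (𝓝 (crossingDensity μ₁ μ₂ H)) := by
  let Z (n : ℕ) (ω : Ω) : Fin n → S2 × S2 := fun i => (A n ω i, B n ω i)
  have hZ (n : ℕ) : HasLaw (Z n) (Measure.pi fun _ => μ₁.prod μ₂) P :=
    ((measurePreserving_arrowProdEquivProdArrow S2 S2 (Fin n) (fun _ => μ₁)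
      fun _ => μ₂).symm.hasLaw).comp (hAB n)
  let m (n : ℕ) : ℝ := ∫ z : Fin n → S2 × S2, drawingDensity H z
    ∂(Measure.pi fun _ => μ₁.prod μ₂)
  have hBC (j : ℕ) : ∀ᵐ ω ∂P, ∀ᶠ n in atTop,
      ω ∉ {ω | 1 / ((j : ℝ) + 1) ≤ |drawingDensity H (Z n ω) - m n|} := by
    refine ae_eventually_notMem (ne_top_of_le_ne_top ?_ (ENNReal.tsum_le_tsum (g := fun n : ℕ =>
      ENNReal.ofReal (2 * Real.exp (n * -((1 / ((j : ℝ) + 1)) ^ 2 / (8 * (k + 1) ^ 2)))))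
      fun n => ?_))
    · refine Summable.tsum_ofReal_ne_top (Summable.mul_left _ ?_)
      exact Real.summable_exp_nat_mul_iff.2 (neg_lt_zero.2 (by positivity))
    · have hmeas : MeasurableSet {z : Fin n → S2 × S2 |
          1 / ((j : ℝ) + 1) ≤ |drawingDensity H z - m n|} :=
        measurableSet_le measurable_const
          (((measurable_drawingDensity H).sub_const _).abs)
      rw [(hZ n).measure_eq hmeas]
      exact measure_le_abs_drawingDensity_sub μ₁ μ₂ H (by positivity)
  filter_upwards [ae_all_iff.2 hBC] with ω hω
  have h0 : Tendsto (fun n => drawingDensity H (Z n ω) - m n) atTop (𝓝 0) := by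
    refine Metric.tendsto_nhds.2 fun δ hδ => ?_
    obtain ⟨j, hj⟩ := exists_nat_one_div_lt hδ
    filter_upwards [hω j] with n hn
    rw [Real.dist_eq, sub_zero]
    exact (not_le.1 hn).trans hj
  have h := h0.add (tendsto_integral_drawingDensity μ₁ μ₂ H)
  simpa [m, drawingDensity, Z] using h

/-! ### The crossing graphon -/

theorem isCrossingGraphon_crossingGraphon (μ₁ μ₂ : Measure S2) [IsProbabilityMeasure μ₁]
    [IsProbabilityMeasure μ₂] {f : I → S2 × S2} (hf : Measurable f)
    (hmap : volume.map f = μ₁.prod μ₂) :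
    IsCrossingGraphon.{u} μ₁ μ₂ (crossingGraphon f hf) := by
  intro Ω _ P _ A B hAB
  refine ae_all_iff.2 fun k => ae_all_iff.2 fun H => ?_
  filter_upwards [ae_tendsto_graphHomDensity μ₁ μ₂ P hAB H] with ω hω
  rwa [homDensity_crossingGraphon μ₁ μ₂ hf hmap]

theorem exists_isRandomDrawingSequence (μ₁ μ₂ : Measure S2) [IsProbabilityMeasure μ₁]
    [IsProbabilityMeasure μ₂] :
    ∃ (Ω : Type u) (_ : MeasurableSpace Ω) (P : Measure Ω) (A B : ∀ n : ℕ, Ω → Fin n → S2),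
      IsProbabilityMeasure P ∧ IsRandomDrawingSequence μ₁ μ₂ P A B := by
  let Q := Measure.infinitePi fun n : ℕ =>
    (Measure.pi fun _ : Fin n => μ₁).prod (Measure.pi fun _ : Fin n => μ₂)
  let e : (∀ n : ℕ, (Fin n → S2) × (Fin n → S2)) ≃ᵐ
      ULift.{u} (∀ n : ℕ, (Fin n → S2) × (Fin n → S2)) := MeasurableEquiv.ulift.symm
  have he : MeasurePreserving e.symm (Q.map e) Q :=
    MeasurePreserving.symm e ⟨e.measurable, rfl⟩
  refine ⟨_, inferInstance, Q.map e, fun n ω => (e.symm ω n).1, fun n ω => (e.symm ω n).2,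
    Measure.isProbabilityMeasure_map e.measurable.aemeasurable, fun n => ?_⟩
  exact ((measurePreserving_eval_infinitePi (fun n : ℕ =>
    (Measure.pi fun _ : Fin n => μ₁).prod (Measure.pi fun _ : Fin n => μ₂)) n).comp he).hasLaw

/-- The densities of a crossing graphon are determined: both sides are limits of the densities
along one random sequence of drawings. -/
theorem IsCrossingGraphon.homDensity_eq {μ₁ μ₂ : Measure S2} [IsProbabilityMeasure μ₁]
    [IsProbabilityMeasure μ₂] {W : Graphon} (hW : IsCrossingGraphon.{u} μ₁ μ₂ W) {k : ℕ}
    (H : SimpleGraph (Fin k)) : W.homDensity H = crossingDensity μ₁ μ₂ H := by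
  obtain ⟨Ω, _, P, A, B, _, hAB⟩ := exists_isRandomDrawingSequence.{u} μ₁ μ₂
  obtain ⟨ω, h₁, h₂⟩ := ((hW Ω P A B hAB).and (ae_tendsto_graphHomDensity μ₁ μ₂ P hAB H)).exists
  exact tendsto_nhds_unique (h₁ k H) h₂

theorem theorem3 (μ₁ μ₂ : Measure S2) [IsProbabilityMeasure μ₁] [IsProbabilityMeasure μ₂]
    (hnd₁ : Nondegenerate μ₁) (hnd₂ : Nondegenerate μ₂)
    (has₁ : AntipodallySymmetric μ₁) (has₂ : AntipodallySymmetric μ₂) :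
    (∃ W : Graphon, IsCrossingGraphon.{u} μ₁ μ₂ W) ∧
      ∀ W : Graphon, IsCrossingGraphon.{u} μ₁ μ₂ W →
        W.homDensity (⊤ : SimpleGraph (Fin 2)) = 1 / 8 := by
  have := (μ₁.prod μ₂).nonempty_of_neZero
  obtain ⟨f, hf, hmap⟩ := (μ₁.prod μ₂).exists_measurable_map_eq
  refine ⟨⟨_, isCrossingGraphon_crossingGraphon μ₁ μ₂ hf hmap⟩, fun W hW => ?_⟩
  rw [hW.homDensity_eq, crossingDensity_top_two μ₁ μ₂ hnd₁ hnd₂ has₁ has₂]
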